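/- Let $\mathcal L_R(\mathbb R^n\times\mathbb R^m)$ be the class of differentiable functions $\mathbf L(\mathbf x,\mathbf y)$, convex in $\mathbf x\in\mathbb R^n$ and concave in $\mathbf y\in\mathbb R^m$, whose saddle operator $\mathbf G=(\nabla_{\mathbf x}\mathbf L,-\nabla_{\mathbf y}\mathbf L)$ is $R$-Lipschitz; write $\mathbf z=(\mathbf x,\mathbf y)$. A (deterministic) algorithm $\mathcal A$ produces, from a starting point $\mathbf z^0$ and a function $\mathbf L$, iterates $\mathbf z^k=\mathcal A(\mathbf z^0,\dots,\mathbf z^{k-1};\mathbf L)$, $k\ge1$. It belongs to $\mathfrak A_{\mathrm{sep}}$ if for all $\mathbf L\in\mathcal L_R$, all $\mathbf z^0$ and all $k$, $$\mathbf x^k\in\mathbf x^0+\mathrm{span}\{\nabla_{\mathbf x}\mathbf L(\mathbf z^0),\dots,\nabla_{\mathbf x}\mathbf L(\mathbf z^{k-1})\},\qquad \mathbf y^k\in\mathbf y^0+\mathrm{span}\{\nabla_{\mathbf y}\mathbf L(\mathbf z^0),\dots,\nabla_{\mathbf y}\mathbf L(\mathbf z^{k-1})\}.$$ For $D>0$ let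 $\mathcal C(\mathcal A;D,k)$ be the supremum of $\|\nabla\mathbf L(\mathbf z^k)\|^2$ over all $\mathbf L\in\mathcal L_R$, all saddle points $\mathbf z^\star$ of $\mathbf L$ and all $\mathbf z^0$ with $\|\mathbf z^0-\mathbf z^\star\|\le D$. (i) Let $R,D>0$, $k\ge 0$ and $n\ge k+2$, and let $\mathcal A\in\mathfrak A_{\mathrm{sep}}$ be an algorithm for $\mathcal L_R(\mathbb R^n\times\mathbb R^n)$. For every $\mathbf z^0$ there is an $\mathbf L\in\mathcal L_R(\mathbb R^n\times\mathbb R^n)$ with a saddle point $\mathbf z^\star$ closest to $\mathbf z^0$ such that $\|\mathbf z^0-\mathbf z^\star\|=D$ and $$\|\nabla\mathbf L(\mathbf z^k)\|^2\ \ge\ \frac{R^2\|\mathbf z^0-\mathbf z^\star\|^2}{(2\lfloor k/2\rfloor+1)^2}.$$ In particular $\mathcal C(\mathcal A;D,k)\ge R^2D^2/(2\lfloor k/2\rfloor+1)^2$. (ii) Consider the iteration $$\mathbf z^{k+1/2}=\mathbf z^k+\tfrac1{k+2}(\mathbf z^0-\mathbf z^k)-\alpha_k\mathbf G(\mathbf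 z^k),\qquad \mathbf z^{k+1}=\mathbf z^k+\tfrac1{k+2}(\mathbf z^0-\mathbf z^k)-\alpha_k\mathbf G(\mathbf z^{k+1/2}),$$ with either (EAG-C) $\alpha_k=\alpha>0$ constant, where $1-3\alpha R-\alpha^2R^2-\alpha^3R^3\ge0$ and $1-8\alpha R+\alpha^2R^2-2\alpha^3R^3\ge0$, or (EAG-V) $\alpha_0\in(0,\frac3{4R})$ and $\alpha_{k+1}=\frac{\alpha_k}{1-\alpha_k^2R^2}\bigl(1-\frac{(k+2)^2}{(k+1)(k+3)}\alpha_k^2R^2\bigr)$. There is a constant $c$, depending only on $\alpha R$ (respectively on $\alpha_0R$), such that the following holds. For all $n,m$, all $\mathbf L\in\mathcal L_R(\mathbb R^n\times\mathbb R^m)$, all saddle points $\mathbf z^\star$ of $\mathbf L$, all $\mathbf z^0$ and all $k\ge0$, $$\|\nabla\mathbf L(\mathbf z^k)\|^2\le \frac{c\,R^2\|\mathbf z^0-\mathbf z^\star\|^2}{(k+1)^2}.$$ With $\mathbf z^0,\mathbf z^{1/2},\mathbf z^1,\mathbf z^{3/2},\dots$ taken as its iterates, the method belongs to $\mathfrak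 A_{\mathrm{sep}}$, and it is optimal in $\mathfrak A_{\mathrm{sep}}$ up to a constant factor: for all $D>0$, all $k,N\ge0$ with $N\le 2k$, all $n\ge N+2$ and every $\mathcal A\in\mathfrak A_{\mathrm{sep}}$ on $\mathbb R^n\times\mathbb R^n$, the worst case of $\|\nabla\mathbf L(\mathbf z^k)\|^2$ for the method over $\mathbf L\in\mathcal L_R(\mathbb R^n\times\mathbb R^n)$, its saddle points $\mathbf z^\star$ and $\|\mathbf z^0-\mathbf z^\star\|\le D$ is at most $c\,\mathcal C(\mathcal A;D,N)$. -/

import Mathlib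

noncomputable section

/-- The space `ℝⁿ × ℝᵐ` of pairs `z = (x, y)` with its Euclidean norm `‖z‖² = ‖x‖² + ‖y‖²`. -/
abbrev SaddleSpace (n m : ℕ) : Type :=
  WithLp 2 (EuclideanSpace ℝ (Fin n) × EuclideanSpace ℝ (Fin m))

/-- The partial gradient `∇ₓ L (x, y)`. -/
def gradX {n m : ℕ} (L : SaddleSpace n m → ℝ) (z : SaddleSpace n m) : EuclideanSpace ℝ (Fin n) :=
  gradient (fun x => L (WithLp.toLp 2 (x, z.snd))) z.fst

/-- The partial gradient `∇_y L (x, y)`. -/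
def gradY {n m : ℕ} (L : SaddleSpace n m → ℝ) (z : SaddleSpace n m) : EuclideanSpace ℝ (Fin m) :=
  gradient (fun y => L (WithLp.toLp 2 (z.fst, y))) z.snd

/-- The saddle operator `G_L (z) = (∇ₓ L (z), -∇_y L (z))`. -/
def saddleOp {n m : ℕ} (L : SaddleSpace n m → ℝ) (z : SaddleSpace n m) : SaddleSpace n m :=
  WithLp.toLp 2 (gradX L z, -gradY L z)

/-- `L (x, y)` is convex in `x` for every fixed `y` and concave in `y` for every fixed `x`. -/
def IsConvexConcave {n m : ℕ} (L : SaddleSpace n m → ℝ) : Prop :=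
  (∀ y, ConvexOn ℝ Set.univ (fun x => L (WithLp.toLp 2 (x, y)))) ∧
  (∀ x, ConcaveOn ℝ Set.univ (fun y => L (WithLp.toLp 2 (x, y))))

/-- `L` is `R`-smooth: it is differentiable and its saddle operator is `R`-Lipschitz. -/
def IsRSmooth {n m : ℕ} (R : ℝ) (L : SaddleSpace n m → ℝ) : Prop :=
  Differentiable ℝ L ∧ ∀ z w, ‖saddleOp L z - saddleOp L w‖ ≤ R * ‖z - w‖

/-- The class of `R`-smooth convex-concave functions on `ℝⁿ × ℝᵐ`. -/
def SmoothConvexConcave (n m : ℕ) (R : ℝ) : Set (SaddleSpace n m → ℝ) :=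
  {L | IsRSmooth R L ∧ IsConvexConcave L}

/-- `p = (x⋆, y⋆)` is a saddle point: `L (x⋆, y) ≤ L (x⋆, y⋆) ≤ L (x, y⋆)` for all `x`, `y`. -/
def IsSaddlePoint {n m : ℕ} (L : SaddleSpace n m → ℝ) (p : SaddleSpace n m) : Prop :=
  (∀ y, L (WithLp.toLp 2 (p.fst, y)) ≤ L p) ∧ (∀ x, L p ≤ L (WithLp.toLp 2 (x, p.snd)))

/-- `p` is a saddle point of `L` closest to `z₀`. -/
def IsClosestSaddlePoint {n m : ℕ} (L : SaddleSpace n m → ℝ) (z₀ p : SaddleSpace n m) : Prop :=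
  IsSaddlePoint L p ∧ ∀ q, IsSaddlePoint L q → ‖z₀ - p‖ ≤ ‖z₀ - q‖

/-- A deterministic algorithm: `A j (z⁰, …, zʲ) L` is the next iterate `zʲ⁺¹`. -/
abbrev MinimaxAlg (n m : ℕ) : Type :=
  (j : ℕ) → (Fin (j + 1) → SaddleSpace n m) → (SaddleSpace n m → ℝ) → SaddleSpace n m

/-- The iterates `z⁰, z¹, …` that the algorithm produces on `L` from the starting point `z⁰`. -/
def MinimaxAlg.iter {n m : ℕ} (A : MinimaxAlg n m) (L : SaddleSpace n m → ℝ)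
    (z₀ : SaddleSpace n m) : ℕ → SaddleSpace n m
  | 0 => z₀
  | j + 1 => A j (fun i : Fin (j + 1) => MinimaxAlg.iter A L z₀ i) L
  termination_by k => k
  decreasing_by exact i.isLt

/-- The class `𝔄_sep` for `R`-smooth convex-concave problems on `ℝⁿ × ℝᵐ`: on every problem of the
class, `xᵏ ∈ x⁰ + span {∇ₓ L (zⁱ) : i < k}` and `yᵏ ∈ y⁰ + span {∇_y L (zⁱ) : i < k}`. -/
def AlgSep (n m : ℕ) (R : ℝ) : Set (MinimaxAlg n m) :=
  {A | ∀ L ∈ SmoothConvexConcave n m R, ∀ (z₀ : SaddleSpace n m) (k : ℕ),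
    (A.iter L z₀ k).fst - z₀.fst ∈
      Submodule.span ℝ {g | ∃ i < k, g = gradX L (A.iter L z₀ i)} ∧
    (A.iter L z₀ k).snd - z₀.snd ∈
      Submodule.span ℝ {g | ∃ i < k, g = gradY L (A.iter L z₀ i)}}

/-- Worst-case complexity at iteration `k`: the supremum of `‖∇ L (zᵏ)‖²` over all `R`-smooth
convex-concave `L`, all saddle points `z⋆` of `L`, and all `z⁰` with `‖z⁰ - z⋆‖ ≤ D`. -/
def worstCase {n m : ℕ} (R D : ℝ) (A : MinimaxAlg n m) (k : ℕ) : ENNReal :=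
  ⨆ (L ∈ SmoothConvexConcave n m R) (p : SaddleSpace n m) (_ : IsSaddlePoint L p)
    (z₀ ∈ Metric.closedBall p D), ENNReal.ofReal (‖gradient L (A.iter L z₀ k)‖ ^ 2)

/-- The extra anchored gradient method with step-sizes `α k` and anchoring coefficients
`1 / (k + 2)`, its intermediate points being counted as iterates: the iterate `2 * k` is `zᵏ`
and the iterate `2 * k + 1` is `zᵏ⁺¹ᐟ²`. -/
def eag (n m : ℕ) (α : ℕ → ℝ) : MinimaxAlg n m := fun j w L =>
  w ⟨2 * (j / 2), by omega⟩
    + (1 / ((j / 2 : ℕ) + 2 : ℝ)) • (w 0 - w ⟨2 * (j / 2), by omega⟩)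
    - α (j / 2) • saddleOp L (w (Fin.last j))

/-- `zᵏ⁺¹ᐟ² = zᵏ + (z⁰ - zᵏ) / (k + 2) - αₖ G (zᵏ)`. -/
theorem eag_iter_half {n m : ℕ} (α : ℕ → ℝ) (L : SaddleSpace n m → ℝ) (z₀ : SaddleSpace n m)
    (k : ℕ) :
    (eag n m α).iter L z₀ (2 * k + 1) = (eag n m α).iter L z₀ (2 * k)
      + (1 / (k + 2 : ℝ)) • (z₀ - (eag n m α).iter L z₀ (2 * k))
      - α k • saddleOp L ((eag n m α).iter L z₀ (2 * k)) := by
  have h : 2 * k / 2 = k := by omega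
  rw [MinimaxAlg.iter]
  simp [eag, h, MinimaxAlg.iter]

/-- `zᵏ⁺¹ = zᵏ + (z⁰ - zᵏ) / (k + 2) - αₖ G (zᵏ⁺¹ᐟ²)`. -/
theorem eag_iter_succ {n m : ℕ} (α : ℕ → ℝ) (L : SaddleSpace n m → ℝ) (z₀ : SaddleSpace n m)
    (k : ℕ) :
    (eag n m α).iter L z₀ (2 * (k + 1)) = (eag n m α).iter L z₀ (2 * k)
      + (1 / (k + 2 : ℝ)) • (z₀ - (eag n m α).iter L z₀ (2 * k))
      - α k • saddleOp L ((eag n m α).iter L z₀ (2 * k + 1)) := by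
  have h : (2 * k + 1) / 2 = k := by omega
  have e : 2 * (k + 1) = (2 * k + 1) + 1 := by ring
  rw [e, MinimaxAlg.iter]
  simp [eag, h, MinimaxAlg.iter]

/-- EAG-C: constant step-size `α`. -/
def eagC (n m : ℕ) (α : ℝ) : MinimaxAlg n m := eag n m (fun _ => α)

/-- The step-sizes of EAG-V. -/
def eagVStep (R α₀ : ℝ) : ℕ → ℝ
  | 0 => α₀
  | k + 1 => eagVStep R α₀ k / (1 - eagVStep R α₀ k ^ 2 * R ^ 2) *
      (1 - ((k : ℝ) + 2) ^ 2 / (((k : ℝ) + 1) * ((k : ℝ) + 3)) * eagVStep R α₀ k ^ 2 * R ^ 2)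

/-- EAG-V: varying step-sizes starting from `α₀`. -/
def eagV (n m : ℕ) (R α₀ : ℝ) : MinimaxAlg n m := eag n m (eagVStep R α₀)

/-- Among the algorithms of `𝔄_sep`, the method `E` (whose iterate `2 * k` is the result of `k`
two-gradient iterations) is optimal up to the constant factor `c`: its worst case after `k`
iterations is at most `c` times the worst case at iterate `N` of any algorithm of the class that
has made no more than the same number `2 * k` of gradient evaluations, in dimension
`n ≥ N + 2`. -/
def IsOptimalUpTo (c R : ℝ) (E : (n m : ℕ) → MinimaxAlg n m) : Prop :=
  (∀ n m : ℕ, E n m ∈ AlgSep n m R) ∧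
  ∀ D : ℝ, 0 < D → ∀ n k N : ℕ, N ≤ 2 * k → N + 2 ≤ n → ∀ A ∈ AlgSep n n R,
    worstCase R D (E n n) (2 * k) ≤ ENNReal.ofReal c * worstCase R D A N

/-- The method `E` (whose iterate `2 * k` is the result of `k` two-gradient iterations) satisfies
`‖∇ L (zᵏ)‖² ≤ c R² ‖z⁰ - z⋆‖² / (k + 1)²` for every `R`-smooth convex-concave `L`. -/
def HasQuadraticRate (c R : ℝ) (E : (n m : ℕ) → MinimaxAlg n m) : Prop :=
  ∀ n m : ℕ, ∀ L ∈ SmoothConvexConcave n m R, ∀ p : SaddleSpace n m, IsSaddlePoint L p →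
    ∀ (z₀ : SaddleSpace n m) (k : ℕ),
      ‖gradient L ((E n m).iter L z₀ (2 * k))‖ ^ 2
        ≤ c * R ^ 2 * ‖z₀ - p‖ ^ 2 / ((k : ℝ) + 1) ^ 2

end

open scoped RealInnerProductSpace

/-! Upper bound. Along the iterates the energy `A k * ‖G(zᵏ)‖² + (k + 1) * ⟪G(zᵏ), zᵏ - z⁰⟫` does
not increase, for weights `A k` of order `k²`. Take the decrease in one step and subtract a multiple
of the monotonicity inequality between `zᵏ` and `zᵏ⁺¹` and a multiple `τ` of the Lipschitz
inequality between `zᵏ⁺¹ᐟ²` and `zᵏ⁺¹`. What remains is a quadratic form in three values of `G`,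
which splits into two binary forms; hence the two discriminant conditions in `anchored_energy_step`.
Monotonicity at `z⋆` bounds the energy below, which gives `eag_rate`. EAG-C and EAG-V differ only in
the choice of weights.

Lower bound. On `⟪A (x - a), y - b⟫` with `A = R diag(l)`, the partial gradients after `k` steps
have the form `R l (l Q(l) - 1) s` with `deg Q < k`, where `s` is the displacement from the start to
the saddle point. Among the polynomials `X (1 - X Q)` with `deg Q < N`, `N` odd, the smallest sup
norm on `[-1, 1]` is `1 / N`, attained by `T_N / T_N'(0)`. Dual weights on the extremal points of
`T_N` turn this into an `ℓ²` bound valid for all `Q` at once (`exists_chebyshev_weights`). Taking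
these points as `l` and `s²` proportional to the weights gives one hard function for the whole
class. -/

theorem ConvexOn.add_inner_le_of_hasGradientAt {E : Type*} [NormedAddCommGroup E]
    [InnerProductSpace ℝ E] [CompleteSpace E] {f : E → ℝ} (hf : ConvexOn ℝ Set.univ f)
    {x g : E} (hg : HasGradientAt f g x) (y : E) : f x + ⟪g, y - x⟫ ≤ f y := by
  have hconv : ConvexOn ℝ Set.univ (fun t : ℝ => f (AffineMap.lineMap x y t)) :=
    hf.comp_affineMap (AffineMap.lineMap x y)
  have hd : HasDerivAt (fun t : ℝ => f (AffineMap.lineMap x y t)) ⟪g, y - x⟫ 0 := by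
    have h1 : HasDerivAt (fun t : ℝ => AffineMap.lineMap x y t) (y - x) (0 : ℝ) :=
      AffineMap.hasDerivAt_lineMap
    have h2 : HasFDerivAt f (InnerProductSpace.toDual ℝ E g) (AffineMap.lineMap x y (0 : ℝ)) := by
      simpa using hg.hasFDerivAt
    exact h2.comp_hasDerivAt (0 : ℝ) h1
  have := hconv.le_slope_of_hasDerivAt (Set.mem_univ 0) (Set.mem_univ 1) one_pos hd
  simp [slope_def_field] at this
  linarith

/-! ### Partial gradients and monotonicity of the saddle operator. -/

section SaddleOperator

variable {n m : ℕ} {R : ℝ} {L : SaddleSpace n m → ℝ}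

theorem hasFDerivAt_toLp_left (x : EuclideanSpace ℝ (Fin n)) (y : EuclideanSpace ℝ (Fin m)) :
    HasFDerivAt (fun x => (WithLp.toLp 2 (x, y) : SaddleSpace n m))
      ((WithLp.prodContinuousLinearEquiv 2 ℝ _ _).symm.toContinuousLinearMap.comp
        (ContinuousLinearMap.inl ℝ _ _)) x :=
  (WithLp.prodContinuousLinearEquiv 2 ℝ (EuclideanSpace ℝ (Fin n))
    (EuclideanSpace ℝ (Fin m))).symm.hasFDerivAt.comp x (hasFDerivAt_prodMk_left x y)

theorem hasFDerivAt_toLp_right (x : EuclideanSpace ℝ (Fin n)) (y : EuclideanSpace ℝ (Fin m)) :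
    HasFDerivAt (fun y => (WithLp.toLp 2 (x, y) : SaddleSpace n m))
      ((WithLp.prodContinuousLinearEquiv 2 ℝ _ _).symm.toContinuousLinearMap.comp
        (ContinuousLinearMap.inr ℝ _ _)) y :=
  (WithLp.prodContinuousLinearEquiv 2 ℝ (EuclideanSpace ℝ (Fin n))
    (EuclideanSpace ℝ (Fin m))).symm.hasFDerivAt.comp y (hasFDerivAt_prodMk_right x y)

theorem hasGradientAt_gradX (hL : Differentiable ℝ L) (z : SaddleSpace n m) :
    HasGradientAt (fun x => L (WithLp.toLp 2 (x, z.snd))) (gradX L z) z.fst :=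
  (DifferentiableAt.comp z.fst (hL z)
    (hasFDerivAt_toLp_left z.fst z.snd).differentiableAt).hasGradientAt

theorem hasGradientAt_gradY (hL : Differentiable ℝ L) (z : SaddleSpace n m) :
    HasGradientAt (fun y => L (WithLp.toLp 2 (z.fst, y))) (gradY L z) z.snd :=
  (DifferentiableAt.comp z.snd (hL z)
    (hasFDerivAt_toLp_right z.fst z.snd).differentiableAt).hasGradientAt

theorem inner_gradX (hL : Differentiable ℝ L) (z : SaddleSpace n m)
    (u : EuclideanSpace ℝ (Fin n)) :
    ⟪gradX L z, u⟫ = ⟪gradient L z, WithLp.toLp 2 (u, 0)⟫ := by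
  have h := (hasGradientAt_gradX hL z).hasFDerivAt.unique
    (HasFDerivAt.comp z.fst (g := L) (hL z).hasGradientAt.hasFDerivAt
      (hasFDerivAt_toLp_left z.fst z.snd))
  simpa using congrArg (fun T => T u) h

theorem inner_gradY (hL : Differentiable ℝ L) (z : SaddleSpace n m)
    (v : EuclideanSpace ℝ (Fin m)) :
    ⟪gradY L z, v⟫ = ⟪gradient L z, WithLp.toLp 2 (0, v)⟫ := by
  have h := (hasGradientAt_gradY hL z).hasFDerivAt.unique
    (HasFDerivAt.comp z.snd (g := L) (hL z).hasGradientAt.hasFDerivAt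
      (hasFDerivAt_toLp_right z.fst z.snd))
  simpa using congrArg (fun T => T v) h

theorem gradient_eq_toLp (hL : Differentiable ℝ L) (z : SaddleSpace n m) :
    gradient L z = WithLp.toLp 2 (gradX L z, gradY L z) := by
  refine ext_inner_right ℝ fun w => ?_
  have hw : w = WithLp.toLp 2 (w.fst, 0) + WithLp.toLp 2 (0, w.snd) := by
    rw [← WithLp.toLp_add]; simp; rfl
  conv_lhs => rw [hw, inner_add_right, ← inner_gradX hL, ← inner_gradY hL]
  simp [WithLp.prod_inner_apply]

theorem norm_gradient_sq (hL : Differentiable ℝ L) (z : SaddleSpace n m) :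
    ‖gradient L z‖ ^ 2 = ‖gradX L z‖ ^ 2 + ‖gradY L z‖ ^ 2 := by
  simp [gradient_eq_toLp hL, WithLp.prod_norm_sq_eq_of_L2]

theorem norm_saddleOp_sq (L : SaddleSpace n m → ℝ) (z : SaddleSpace n m) :
    ‖saddleOp L z‖ ^ 2 = ‖gradX L z‖ ^ 2 + ‖gradY L z‖ ^ 2 := by
  simp [saddleOp, WithLp.prod_norm_sq_eq_of_L2]

/-- Sum of four first-order inequalities, in each variable at `z` and at `w`; the values of `L` at
`z`, `w` and the two mixed points cancel. -/
theorem inner_saddleOp_sub_nonneg (hL : Differentiable ℝ L) (hc : IsConvexConcave L)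
    (z w : SaddleSpace n m) : 0 ≤ ⟪saddleOp L z - saddleOp L w, z - w⟫ := by
  have hx (a b : SaddleSpace n m) := (hc.1 a.snd).add_inner_le_of_hasGradientAt
    (hasGradientAt_gradX hL a) b.fst
  have hy (a b : SaddleSpace n m) :
      L (WithLp.toLp 2 (a.fst, b.snd)) ≤ L a + ⟪gradY L a, b.snd - a.snd⟫ := by
    have h := (hc.2 a.fst).neg.add_inner_le_of_hasGradientAt (x := a.snd) (g := -gradY L a)
      (by
        have := (hasGradientAt_gradY hL a).hasFDerivAt.neg
        rw [hasGradientAt_iff_hasFDerivAt, map_neg]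
        exact this) b.snd
    simp only [Pi.neg_apply, inner_neg_left] at h
    change -L a + _ ≤ _ at h
    linarith
  have h1 := hx z w
  have h2 := hx w z
  have h3 := hy z w
  have h4 := hy w z
  change L z + _ ≤ _ at h1
  change L w + _ ≤ _ at h2
  have h5 : ⟪saddleOp L z - saddleOp L w, z - w⟫ = ⟪gradX L z - gradX L w, z.fst - w.fst⟫
      + ⟪-gradY L z - -gradY L w, z.snd - w.snd⟫ := rfl
  rw [h5]
  simp only [inner_sub_left, inner_sub_right, inner_neg_left] at *
  linarith

theorem saddleOp_eq_zero (hL : Differentiable ℝ L) {p : SaddleSpace n m}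
    (hp : IsSaddlePoint L p) : saddleOp L p = 0 := by
  have hx : gradX L p = 0 := by
    have : IsLocalMin (fun x => L (WithLp.toLp 2 (x, p.snd))) p.fst :=
      Filter.Eventually.of_forall hp.2
    simpa using this.hasFDerivAt_eq_zero (hasGradientAt_gradX hL p).hasFDerivAt
  have hy : gradY L p = 0 := by
    have : IsLocalMax (fun y => L (WithLp.toLp 2 (p.fst, y))) p.snd :=
      Filter.Eventually.of_forall hp.1
    simpa using this.hasFDerivAt_eq_zero (hasGradientAt_gradY hL p).hasFDerivAt
  simp [saddleOp, hx, hy]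

end SaddleOperator

/-! ### Energy argument for extra anchored gradient. -/

section Energy

variable {E : Type*} [NormedAddCommGroup E] [InnerProductSpace ℝ E]

theorem quadratic_form_nonneg {a b c : ℝ} (ha : 0 ≤ a) (hc : 0 ≤ c) (h : b ^ 2 ≤ a * c) (u v : E) :
    0 ≤ a * ‖u‖ ^ 2 - 2 * b * ⟪u, v⟫ + c * ‖v‖ ^ 2 := by
  -- The degenerate case `a = 0` does occur: it is the first form of EAG-V.
  rcases ha.eq_or_lt with rfl | ha
  · have : b = 0 := by nlinarith
    subst this
    have := mul_nonneg hc (sq_nonneg ‖v‖)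
    linarith
  · have h1 : 0 ≤ ‖a • u - b • v‖ ^ 2 := sq_nonneg _
    rw [norm_sub_sq_real, norm_smul, norm_smul, inner_smul_left, inner_smul_right, mul_pow, mul_pow,
      Real.norm_eq_abs, Real.norm_eq_abs, sq_abs, sq_abs] at h1
    have h2 := mul_le_mul_of_nonneg_right h (sq_nonneg ‖v‖)
    refine nonneg_of_mul_nonneg_right (a := a) ?_ ha
    simp only [RCLike.conj_to_real] at h1
    nlinarith

/-- One step of extra anchored gradient does not increase the energy: `z`, `g`, `h`, `g'` are the
displacement from the anchor and the values of the operator at `zᵏ`, `zᵏ⁺¹ᐟ²`, `zᵏ⁺¹`. -/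
theorem anchored_energy_step {z z' g h g' : E} {K α t M A A' τ c₁ c₂ : ℝ} (hK : 0 < K)
    (hM : M = α * K * (K + 1) / 2)
    (hz' : z' = (K / (K + 1)) • z - α • h)
    (hmono : 0 ≤ ⟪g - g', z - z'⟫) (hlip : ‖h - g'‖ ^ 2 ≤ t ^ 2 * ‖g - h‖ ^ 2)
    (hτ : 0 ≤ τ) (hc : c₁ + c₂ = τ * (1 - t ^ 2)) (hc₁ : 0 ≤ c₁) (hc₂ : 0 ≤ c₂)
    (hA : 0 ≤ A - τ * t ^ 2) (hA' : 0 ≤ τ - A')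
    (h₁ : (M - τ * t ^ 2) ^ 2 ≤ (A - τ * t ^ 2) * c₁)
    (h₂ : (τ - M * ((K + 1) / K)) ^ 2 ≤ c₂ * (τ - A')) :
    A' * ‖g'‖ ^ 2 + (K + 1) * ⟪g', z'⟫ ≤ A * ‖g‖ ^ 2 + K * ⟪g, z⟫ := by
  -- Once `K (K + 1)` times `hmono` and `τ` times `hlip` are used, no term in `z` and no `⟪g, g'⟫`
  -- is left. The forms in `(g, h)` and `(h, g')` share the coefficient `τ (1 - t²)` of `‖h‖²`,
  -- divided as `c₁ + c₂`.
  have q₁ := quadratic_form_nonneg hA hc₁ h₁ g h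
  have q₂ := quadratic_form_nonneg hc₂ hA' h₂ h g'
  have hl := mul_le_mul_of_nonneg_left hlip hτ
  have hm : 0 ≤ K * (K + 1) * ⟪g - g', z - z'⟫ := by positivity
  have ec : c₂ = τ * (1 - t ^ 2) - c₁ := by linarith
  subst hM hz' ec
  have e : z - ((K / (K + 1)) • z - α • h) = (1 / (K + 1)) • z + α • h := by
    have : (1 : ℝ) / (K + 1) = 1 - K / (K + 1) := by field_simp; ring
    rw [this, sub_smul, one_smul]; abel
  rw [e] at hm
  rw [norm_sub_sq_real, norm_sub_sq_real] at hl
  simp only [inner_sub_left, inner_sub_right, inner_add_right, inner_smul_right] at hm ⊢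
  have hm' : K * (K + 1) * (1 / (K + 1) * (⟪g, z⟫ - ⟪g', z⟫)
      + α * (⟪g, h⟫ - ⟪g', h⟫)) = K * ⟪g, z⟫ - K * ⟪g', z⟫
      + K * (K + 1) * α * ⟪g, h⟫ - K * (K + 1) * α * ⟪g', h⟫ := by
    field_simp; ring
  rw [hm'] at hm
  have e2 : (K + 1) * (K / (K + 1) * ⟪g', z⟫ - α * ⟪g', h⟫)
      = K * ⟪g', z⟫ - (K + 1) * α * ⟪g', h⟫ := by field_simp
  have e3 : α * K * (K + 1) / 2 * ((K + 1) / K) = α * (K + 1) * (K + 1) / 2 := by field_simp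
  rw [e3] at q₂
  rw [e2]
  rw [real_inner_comm h g'] at hm ⊢
  nlinarith

end Energy

section EAG

variable {n m : ℕ} {R : ℝ} {L : SaddleSpace n m → ℝ} {α : ℕ → ℝ}

/-- If the weights `A` make the energy of extra anchored gradient nonincreasing and grow
quadratically, the squared gradient norm decays quadratically. -/
theorem eag_rate (hL : L ∈ SmoothConvexConcave n m R) {p : SaddleSpace n m}
    (hp : IsSaddlePoint L p) (z₀ : SaddleSpace n m) {A τ c₁ c₂ : ℕ → ℝ} {a : ℝ} (ha : 0 < a)
    (hAa : ∀ k : ℕ, a / 2 * (k + 1) ^ 2 ≤ A k)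
    (hτ : ∀ k, 0 ≤ τ k) (hc : ∀ k, c₁ k + c₂ k = τ k * (1 - (α k * R) ^ 2))
    (hc₁ : ∀ k, 0 ≤ c₁ k) (hc₂ : ∀ k, 0 ≤ c₂ k)
    (hA : ∀ k, 0 ≤ A k - τ k * (α k * R) ^ 2) (hA' : ∀ k, 0 ≤ τ k - A (k + 1))
    (h₁ : ∀ k : ℕ, (α k * (k + 1) * (k + 2) / 2 - τ k * (α k * R) ^ 2) ^ 2
      ≤ (A k - τ k * (α k * R) ^ 2) * c₁ k)
    (h₂ : ∀ k : ℕ, (τ k - α k * (k + 2) ^ 2 / 2) ^ 2 ≤ c₂ k * (τ k - A (k + 1))) (k : ℕ) :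
    ‖gradient L ((eag n m α).iter L z₀ (2 * k))‖ ^ 2
      ≤ (4 + 4 * a * A 0 * R ^ 2) / a ^ 2 * ‖z₀ - p‖ ^ 2 / ((k : ℝ) + 1) ^ 2 := by
  obtain ⟨⟨hd, hlip⟩, hcc⟩ := hL
  set w : ℕ → SaddleSpace n m := (eag n m α).iter L z₀ with hw
  have hzero : w 0 = z₀ := by rw [hw, MinimaxAlg.iter]
  set V : ℕ → ℝ := fun k => A k * ‖saddleOp L (w (2 * k))‖ ^ 2
    + (k + 1) * ⟪saddleOp L (w (2 * k)), w (2 * k) - z₀⟫ with hV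
  have hstep (k : ℕ) : V (k + 1) ≤ V k := by
    have hk : (0 : ℝ) < (k : ℝ) + 1 := by positivity
    have hhalf := eag_iter_half α L z₀ k
    have hsucc := eag_iter_succ α L z₀ k
    rw [← hw] at hhalf hsucc
    have e : ∀ v : SaddleSpace n m, w (2 * k) + (1 / (k + 2 : ℝ)) • (z₀ - w (2 * k)) - v - z₀
        = (((k : ℝ) + 1) / ((k : ℝ) + 1 + 1)) • (w (2 * k) - z₀) - v := by
      intro v
      have : ((k : ℝ) + 1) / ((k : ℝ) + 1 + 1) = 1 - 1 / (k + 2 : ℝ) := by field_simp; ring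
      rw [this]; module
    have key := anchored_energy_step (z := w (2 * k) - z₀) (z' := w (2 * (k + 1)) - z₀)
      (g := saddleOp L (w (2 * k))) (h := saddleOp L (w (2 * k + 1)))
      (g' := saddleOp L (w (2 * (k + 1)))) (K := k + 1) (α := α k) (t := α k * R) (A := A k)
      (A' := A (k + 1)) (τ := τ k) (c₁ := c₁ k) (c₂ := c₂ k)
      hk rfl (by rw [hsucc, e]) (by
        rw [sub_sub_sub_cancel_right]; exact inner_saddleOp_sub_nonneg hd hcc _ _)
      (by
        have h := hlip (w (2 * k + 1)) (w (2 * (k + 1)))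
        -- Both points carry the same anchor term, so they differ only by the operator values; this
        -- produces the ratio `t = αₖ R`.
        have e2 : w (2 * k + 1) - w (2 * (k + 1))
            = -(α k • (saddleOp L (w (2 * k)) - saddleOp L (w (2 * k + 1)))) :=
          (congrArg₂ (· - ·) hhalf hsucc).trans (by module)
        rw [e2, norm_neg, norm_smul] at h
        calc _ ≤ (R * (‖α k‖ * ‖saddleOp L (w (2 * k)) - saddleOp L (w (2 * k + 1))‖)) ^ 2 := by
              gcongr
          _ = _ := by rw [mul_pow, mul_pow, Real.norm_eq_abs, sq_abs]; ring)
      (hτ k) (hc k) (hc₁ k) (hc₂ k) (hA k) (hA' k)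
      (by convert h₁ k using 3; ring)
      (by convert h₂ k using 3; field_simp; ring)
    simp only [hV]
    push_cast
    exact key
  have hp0 := saddleOp_eq_zero hd hp
  have hVk (k : ℕ) : V k ≤ V 0 := antitone_nat_of_succ_le hstep (Nat.zero_le k)
  have hA0 : 0 ≤ A 0 := le_trans (by positivity) (hAa 0)
  have hV0 : V 0 ≤ A 0 * (R ^ 2 * ‖z₀ - p‖ ^ 2) := by
    have h := hlip z₀ p
    rw [hp0, sub_zero] at h
    have : V 0 = A 0 * ‖saddleOp L z₀‖ ^ 2 := by simp [hV, hzero]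
    rw [this, ← mul_pow]
    gcongr
  -- As `G(z⋆) = 0`, monotonicity allows `zᵏ - z⁰` to be replaced by `z⋆ - z⁰` in a lower bound of
  -- the energy.
  have hmono := inner_saddleOp_sub_nonneg hd hcc (w (2 * k)) p
  rw [hp0, sub_zero] at hmono
  have hcs := neg_le_of_abs_le (abs_real_inner_le_norm (saddleOp L (w (2 * k))) (p - z₀))
  rw [norm_sub_rev p z₀] at hcs
  have hin : -(‖saddleOp L (w (2 * k))‖ * ‖z₀ - p‖)
      ≤ ⟪saddleOp L (w (2 * k)), w (2 * k) - z₀⟫ := by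
    have : w (2 * k) - z₀ = (w (2 * k) - p) + (p - z₀) := by abel
    rw [this, inner_add_right]; linarith
  rw [norm_gradient_sq hd, ← norm_saddleOp_sq]
  have hk : (0 : ℝ) < (k : ℝ) + 1 := by positivity
  have h1 := (hVk k).trans hV0
  simp only [hV] at h1
  have h2 := mul_le_mul_of_nonneg_left hin hk.le
  have h3 := mul_le_mul_of_nonneg_right (hAa k) (sq_nonneg ‖saddleOp L (w (2 * k))‖)
  set u := ((k : ℝ) + 1) * ‖saddleOp L (w (2 * k))‖ with hu
  set D := ‖z₀ - p‖
  have h4 : a / 2 * u ^ 2 - u * D ≤ A 0 * (R ^ 2 * D ^ 2) := by rw [hu]; nlinarith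
  have h5 : a ^ 2 * u ^ 2 ≤ (4 + 4 * a * A 0 * R ^ 2) * D ^ 2 := by
    nlinarith [sq_nonneg (a * u - 2 * D), mul_le_mul_of_nonneg_left h4 ha.le]
  rw [le_div_iff₀ (by positivity), div_mul_eq_mul_div, le_div_iff₀ (by positivity)]
  rw [hu] at h5
  linarith

end EAG

/-! ### Rates of EAG-C and EAG-V. -/

section Rates

theorem eagC_hasQuadraticRate {R α : ℝ} (hR : 0 < R) (hα : 0 < α) (ht : α * R ≤ 1 / 7) :
    HasQuadraticRate ((4 + 3 * (α * R) ^ 2) / (α * R) ^ 2) R (fun n m => eagC n m α) := by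
  intro n m L hL p hp z₀ k
  have htt : (α * R) ^ 2 ≤ 1 / 49 := by
    have : 0 < α * R := by positivity
    nlinarith
  have hs (k : ℕ) : ∃ s v : ℝ, s = k + 2 ∧ v = (α * R) ^ 2 * s ^ 2 ∧ 2 ≤ s ∧ 0 ≤ v ∧
      v ≤ s ^ 2 / 49 :=
    ⟨k + 2, _, rfl, rfl, by linarith [(Nat.cast_nonneg k : (0 : ℝ) ≤ k)], by positivity, by
      nlinarith [sq_nonneg ((k : ℝ) + 2)]⟩
  -- In units of `(α / 2) s²` with `s = k + 2` and `t = α R`, the leading parts are `A ≈ 1`, `τ =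
  -- 7`, `c₁ ≈ 1 - 7 t²`, `c₂ ≈ 6`. Both discriminants vanish at this order, so the inequalities
  -- rest on the lower-order terms `3 / 2`, `s / 2` and `1 / 20`. The bound `t ≤ 1 / 7` keeps `7 t²
  -- ≤ 1 / 7`.
  have h := eag_rate (α := fun _ => α) hL hp z₀ hα
    (A := fun k => α / 2 * ((k + 1) * (k + 3 / 2)))
    (τ := fun k => α / 2 * (7 * (k + 2) ^ 2))
    (c₁ := fun k => α / 2 * ((k + 2) ^ 2 - (k + 2) / 2 - 1 / 20
      - 7 * ((α * R) ^ 2 * (k + 2) ^ 2)))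
    (c₂ := fun k => α / 2 * (6 * (k + 2) ^ 2 + (k + 2) / 2 + 1 / 20))
    (by intro k; rw [sq]; gcongr; norm_num)
    (by intro k; positivity)
    (by intro k; ring)
    (by
      intro k
      obtain ⟨s, v, rfl, hv, h2, h0, h1⟩ := hs k
      simp only [← hv]
      exact mul_nonneg (by positivity) (by nlinarith))
    (by intro k; positivity)
    (by
      intro k
      obtain ⟨s, v, hs, hv, h2, h0, h1⟩ := hs k
      have : α / 2 * ((k + 1) * (k + 3 / 2)) - α / 2 * (7 * ((k : ℝ) + 2) ^ 2) * (α * R) ^ 2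
          = α / 2 * ((s - 1) * (s - 1 / 2) - 7 * v) := by rw [hv, hs]; ring
      rw [this]
      exact mul_nonneg (by positivity) (by nlinarith))
    (by
      intro k
      obtain ⟨s, v, hs, hv, h2, h0, h1⟩ := hs k
      have : α / 2 * (7 * ((k : ℝ) + 2) ^ 2)
          - α / 2 * ((((k + 1 : ℕ) : ℝ) + 1) * (((k + 1 : ℕ) : ℝ) + 3 / 2))
          = α / 2 * (7 * s ^ 2 - s * (s + 1 / 2)) := by rw [hs]; push_cast; ring
      rw [this]
      exact mul_nonneg (by positivity) (by nlinarith))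
    (by
      intro k
      obtain ⟨s, v, hs, hv, h2, h0, h1⟩ := hs k
      have e1 : (α * (k + 1) * (k + 2) / 2 - α / 2 * (7 * ((k : ℝ) + 2) ^ 2) * (α * R) ^ 2) ^ 2
          = (α / 2) ^ 2 * (s ^ 2 - s - 7 * v) ^ 2 := by rw [hv, hs]; ring
      have e2 : (α / 2 * ((k + 1) * (k + 3 / 2)) - α / 2 * (7 * ((k : ℝ) + 2) ^ 2) * (α * R) ^ 2)
            * (α / 2 * ((k + 2) ^ 2 - (k + 2) / 2 - 1 / 20 - 7 * ((α * R) ^ 2 * (k + 2) ^ 2)))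
          = (α / 2) ^ 2 * (((s - 1) * (s - 1 / 2) - 7 * v) * (s ^ 2 - s / 2 - 1 / 20 - 7 * v)) := by
        rw [hv, hs]; ring
      rw [e1, e2]
      refine mul_le_mul_of_nonneg_left ?_ (by positivity)
      -- With `X` the first factor on the right, the claim reads `(X + (s - 1) / 2)² ≤ X (X + (s -
      -- 1) + 9 / 20)`. The second condition below has the same shape.
      have : ((s - 1) / 2) ^ 2 ≤ 9 / 20 * ((s - 1) * (s - 1 / 2) - 7 * v) := by nlinarith
      linarith)
    (by
      intro k
      obtain ⟨s, v, hs, hv, h2, h0, h1⟩ := hs k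
      have e1 : (α / 2 * (7 * ((k : ℝ) + 2) ^ 2) - α * (k + 2) ^ 2 / 2) ^ 2
          = (α / 2) ^ 2 * (6 * s ^ 2) ^ 2 := by rw [hs]; ring
      have e2 : α / 2 * (6 * ((k : ℝ) + 2) ^ 2 + (k + 2) / 2 + 1 / 20) * (α / 2 * (7 * (k + 2) ^ 2)
            - α / 2 * ((((k + 1 : ℕ) : ℝ) + 1) * (((k + 1 : ℕ) : ℝ) + 3 / 2)))
          = (α / 2) ^ 2 * ((6 * s ^ 2 + s / 2 + 1 / 20) * (6 * s ^ 2 - s / 2)) := by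
        rw [hs]; push_cast; ring
      rw [e1, e2]
      refine mul_le_mul_of_nonneg_left ?_ (by positivity)
      have : (s / 2) ^ 2 ≤ 1 / 20 * (6 * s ^ 2 - s / 2) := by nlinarith
      linarith) k
  refine h.trans (le_of_eq ?_)
  simp only [CharP.cast_eq_zero]
  field_simp
  ring

/-- Each step-size is the previous one times `1 - q / ((k + 1) (k + 3))`, where `q = u / (1 - u)`
and `u = (αₖ R)² < 9 / 16`, so `q ≤ 9 / 7`. The comparison sequence `(k + 2) / (k + 1/2)` falls from
`4` to the limit `1`, at each step by at least the factor obtained with `q = 9 / 7`. Hence `αₖ`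
stays above `α₀ / 4`. -/
theorem eagVStep_bounds {R α₀ : ℝ} (hR : 0 < R) (hα₀ : 0 < α₀) (h : α₀ < 3 / (4 * R)) (k : ℕ) :
    α₀ / 4 * ((k + 2) / (k + 1 / 2)) ≤ eagVStep R α₀ k ∧ eagVStep R α₀ k ≤ α₀ := by
  have h34 : α₀ * R < 3 / 4 := by
    rw [lt_div_iff₀ (by positivity)] at h; linarith
  induction k with
  | zero => simp only [eagVStep]; norm_num
  | succ k ih =>
    obtain ⟨ih₁, ih₂⟩ := ih
    set a := eagVStep R α₀ k with ha
    have hk : (0 : ℝ) ≤ k := k.cast_nonneg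
    have ha0 : 0 < a := lt_of_lt_of_le (by positivity) ih₁
    have hu : a ^ 2 * R ^ 2 < 9 / 16 := by
      have : a * R < 3 / 4 := lt_of_le_of_lt (by gcongr) h34
      rw [← mul_pow]; nlinarith [mul_pos ha0 hR]
    set u := a ^ 2 * R ^ 2 with hu'
    have hu0 : 0 < u := by positivity
    -- From `(k + 2)² = (k + 1) (k + 3) + 1`.
    have hrec : eagVStep R α₀ (k + 1) = a * (1 - u / (1 - u) / ((k + 1) * (k + 3))) := by
      rw [eagVStep, ← ha, mul_assoc _ (a ^ 2), ← hu']
      have : 1 - u ≠ 0 := by linarith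
      field_simp
      ring
    have hq : u / (1 - u) ≤ 9 / 7 := by
      rw [div_le_iff₀ (by linarith)]; linarith
    have hq0 : 0 ≤ u / (1 - u) := div_nonneg hu0.le (by linarith)
    set q := u / (1 - u)
    rw [hrec]
    constructor
    · push_cast
      have h1 : 1 - 9 / 7 / (((k : ℝ) + 1) * (k + 3)) ≤ 1 - q / (((k : ℝ) + 1) * (k + 3)) := by
        gcongr
      have h2 : (k + 1 + 2 : ℝ) / (k + 1 + 1 / 2)
          ≤ (k + 2) / (k + 1 / 2) * (1 - 9 / 7 / (((k : ℝ) + 1) * (k + 3))) := by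
        have e : (k + 2 : ℝ) / (k + 1 / 2) * (1 - 9 / 7 / ((k + 1) * (k + 3)))
            = (k + 2) * ((k + 1) * (k + 3) - 9 / 7) / ((k + 1 / 2) * ((k + 1) * (k + 3))) := by
          field_simp
        rw [e, div_le_div_iff₀ (by positivity) (by positivity), ← sub_nonneg]
        have e' : (k + 2 : ℝ) * ((k + 1) * (k + 3) - 9 / 7) * (k + 1 + 1 / 2)
            - (k + 1 + 2) * ((k + 1 / 2) * ((k + 1) * (k + 3)))
            = 3 / 14 * k ^ 2 + 3 / 2 * k + 9 / 14 := by ring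
        rw [e']
        positivity
      have h3 : 0 ≤ 1 - 9 / 7 / (((k : ℝ) + 1) * (k + 3)) := by
        rw [sub_nonneg, div_le_one (by positivity)]; nlinarith
      calc _ ≤ α₀ / 4 * ((k + 2) / (k + 1 / 2) * (1 - 9 / 7 / (((k : ℝ) + 1) * (k + 3)))) := by
            gcongr
        _ = α₀ / 4 * ((k + 2) / (k + 1 / 2)) * (1 - 9 / 7 / (((k : ℝ) + 1) * (k + 3))) := by ring
        _ ≤ _ := by gcongr
    · refine le_trans ?_ ih₂
      have : 0 ≤ q / (((k : ℝ) + 1) * (k + 3)) := by positivity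
      nlinarith

/-- With `A = τ t² = αₖ (k + 1) (k + 2) / 2` the form in `(g, h)` vanishes identically, so `c₁ = 0`.
The step-size recursion says exactly that the other form has discriminant zero (`hdet`). -/
theorem eagV_hasQuadraticRate {R α₀ : ℝ} (hR : 0 < R) (hα₀ : 0 < α₀) (h : α₀ < 3 / (4 * R)) :
    HasQuadraticRate ((4 + (α₀ * R) ^ 2) / ((α₀ * R) / 4) ^ 2) R
      (fun n m => eagV n m R α₀) := by
  intro n m L hL p hp z₀ k
  set α := eagVStep R α₀ with hαdef
  have hlow (k : ℕ) : α₀ / 4 ≤ α k := by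
    refine le_trans ?_ (eagVStep_bounds hR hα₀ h k).1
    have : (1 : ℝ) ≤ (k + 2) / (k + 1 / 2) := by
      rw [le_div_iff₀ (by positivity)]; linarith
    nlinarith
  have hpos (k : ℕ) : 0 < α k := lt_of_lt_of_le (by positivity) (hlow k)
  have ht (k : ℕ) : (α k * R) ^ 2 < 1 := by
    have h34 : α₀ * R < 3 / 4 := by
      rw [lt_div_iff₀ (by positivity)] at h; linarith
    have h1 : α k * R < 3 / 4 :=
      lt_of_le_of_lt (by gcongr; exact (eagVStep_bounds hR hα₀ h k).2) h34
    nlinarith [mul_pos (hpos k) hR]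
  have hτ (k : ℕ) : α k * (k + 1) * (k + 2) / 2 / (α k * R) ^ 2 * (α k * R) ^ 2
      = α k * (k + 1) * (k + 2) / 2 := by
    have := hpos k
    field_simp
  have hτ0 (k : ℕ) : 0 < α k * (k + 1) * (k + 2) / 2 / (α k * R) ^ 2 := by
    have := hpos k
    positivity
  have hdet (k : ℕ) : (α k * (k + 1) * (k + 2) / 2 / (α k * R) ^ 2 - α k * (k + 2) ^ 2 / 2) ^ 2
      = α k * (k + 1) * (k + 2) / 2 / (α k * R) ^ 2 * (1 - (α k * R) ^ 2)
        * (α k * (k + 1) * (k + 2) / 2 / (α k * R) ^ 2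
          - α (k + 1) * ((k + 1 : ℕ) + 1) * ((k + 1 : ℕ) + 2) / 2) := by
    have hrec : α (k + 1) = α k / (1 - α k ^ 2 * R ^ 2) *
      (1 - ((k : ℝ) + 2) ^ 2 / (((k : ℝ) + 1) * ((k : ℝ) + 3)) * α k ^ 2 * R ^ 2) := rfl
    have h1 := hpos k
    have h2 := ht k
    rw [mul_pow] at h2
    have h3 : 1 - α k ^ 2 * R ^ 2 ≠ 0 := by linarith
    rw [hrec]
    push_cast
    rw [mul_pow]
    generalize α k = a at *
    field_simp
    ring
  have h := eag_rate (α := α) hL hp z₀ (a := α₀ / 4) (by positivity)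
    (A := fun k => α k * (k + 1) * (k + 2) / 2)
    (τ := fun k => α k * (k + 1) * (k + 2) / 2 / (α k * R) ^ 2)
    (c₁ := fun k => 0)
    (c₂ := fun k => α k * (k + 1) * (k + 2) / 2 / (α k * R) ^ 2 * (1 - (α k * R) ^ 2))
    (by
      intro k
      have hk : (0 : ℝ) ≤ k := k.cast_nonneg
      have h1 : α₀ / 4 * (((k : ℝ) + 1) * (k + 1)) ≤ α k * ((k + 1) * (k + 2)) := by
        gcongr
        · exact (hpos k).le
        · exact hlow k
        · norm_num
      linarith)
    (fun k => (hτ0 k).le) (fun k => by ring) (fun k => le_rfl)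
    (fun k => mul_nonneg (hτ0 k).le (by linarith [ht k]))
    (fun k => by simp only [hτ, sub_self, le_refl])
    (fun k => by
      have hc := mul_pos (hτ0 k) (sub_pos.2 (ht k))
      exact nonneg_of_mul_nonneg_right ((sq_nonneg _).trans (hdet k).le) hc)
    (fun k => by simp only [hτ, sub_self]; norm_num)
    (fun k => (hdet k).le) k
  refine h.trans (le_of_eq ?_)
  have : α 0 = α₀ := rfl
  simp only [CharP.cast_eq_zero, this]
  field_simp
  ring

end Rates

/-! ### Extra anchored gradient satisfies the span conditions. -/

section SpanMembership

variable {n m : ℕ}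

theorem eag_iter_sub_mem_span (α : ℕ → ℝ) (L : SaddleSpace n m → ℝ) (z₀ : SaddleSpace n m)
    (k : ℕ) :
    ((eag n m α).iter L z₀ k).fst - z₀.fst ∈
      Submodule.span ℝ {g | ∃ i < k, g = gradX L ((eag n m α).iter L z₀ i)} ∧
    ((eag n m α).iter L z₀ k).snd - z₀.snd ∈
      Submodule.span ℝ {g | ∃ i < k, g = gradY L ((eag n m α).iter L z₀ i)} := by
  set w : ℕ → SaddleSpace n m := (eag n m α).iter L z₀ with hw
  have hzero : w 0 = z₀ := by rw [hw, MinimaxAlg.iter]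
  -- Common shape of the two updates: base point `w i` with `i` even, operator evaluated at `w b`.
  -- The induction therefore runs over even indices only.
  have step (i b k : ℕ) (c d : ℝ) (hi : i ≤ k) (hb : b < k)
      (hk : w k = w i + c • (z₀ - w i) - d • saddleOp L (w b))
      (ih : (w i).fst - z₀.fst ∈ Submodule.span ℝ {g | ∃ j < i, g = gradX L (w j)} ∧
        (w i).snd - z₀.snd ∈ Submodule.span ℝ {g | ∃ j < i, g = gradY L (w j)}) :
      (w k).fst - z₀.fst ∈ Submodule.span ℝ {g | ∃ j < k, g = gradX L (w j)} ∧
        (w k).snd - z₀.snd ∈ Submodule.span ℝ {g | ∃ j < k, g = gradY L (w j)} := by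
    constructor
    · have e : (w k).fst - z₀.fst = (1 - c) • ((w i).fst - z₀.fst) - d • gradX L (w b) := by
        rw [hk]
        change (w i).fst + c • (z₀.fst - (w i).fst) - d • gradX L (w b) - z₀.fst = _
        module
      rw [e]
      refine Submodule.sub_mem _ (Submodule.smul_mem _ _ (Submodule.span_mono ?_ ih.1))
        (Submodule.smul_mem _ _ (Submodule.subset_span ⟨b, hb, rfl⟩))
      rintro g ⟨j, hj, rfl⟩
      exact ⟨j, hj.trans_le hi, rfl⟩
    · have e : (w k).snd - z₀.snd = (1 - c) • ((w i).snd - z₀.snd) + d • gradY L (w b) := by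
        rw [hk]
        change (w i).snd + c • (z₀.snd - (w i).snd) - d • -gradY L (w b) - z₀.snd = _
        module
      rw [e]
      refine Submodule.add_mem _ (Submodule.smul_mem _ _ (Submodule.span_mono ?_ ih.2))
        (Submodule.smul_mem _ _ (Submodule.subset_span ⟨b, hb, rfl⟩))
      rintro g ⟨j, hj, rfl⟩
      exact ⟨j, hj.trans_le hi, rfl⟩
  have heven (k : ℕ) :
      (w (2 * k)).fst - z₀.fst ∈ Submodule.span ℝ {g | ∃ j < 2 * k, g = gradX L (w j)} ∧
        (w (2 * k)).snd - z₀.snd ∈ Submodule.span ℝ {g | ∃ j < 2 * k, g = gradY L (w j)} := by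
    induction k with
    | zero => simp [hzero]
    | succ k ih =>
      exact step (2 * k) (2 * k + 1) _ _ _ (by omega) (by omega) (eag_iter_succ α L z₀ k) ih
  obtain ⟨j, rfl | rfl⟩ := Nat.even_or_odd' k
  · exact heven j
  · exact step (2 * j) (2 * j) _ _ _ (by omega) (by omega) (eag_iter_half α L z₀ j) (heven j)

theorem eag_mem_algSep (n m : ℕ) (R : ℝ) (α : ℕ → ℝ) : eag n m α ∈ AlgSep n m R :=
  fun L _ z₀ k => eag_iter_sub_mem_span α L z₀ k

end SpanMembership

/-! ### The Chebyshev extremal problem and its dual weights. -/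

section ChebyshevWeights

open Polynomial Polynomial.Chebyshev

/-- `T_N / T_N'(0)`, a polynomial of the form `X + X² S`. -/
theorem exists_scaled_T_eq {N : ℕ} (hN : Odd N) :
    ∃ (δ : ℝ) (S : ℝ[X]), δ ^ 2 = 1 / (N : ℝ) ^ 2 ∧ S.degree < N ∧
      C δ * T ℝ N = X + X ^ 2 * S := by
  have hN0 : 0 < N := hN.pos
  have hN' : (N : ℝ) ≠ 0 := by positivity
  have hcoeff : ((T ℝ N).coeff 1) ^ 2 = (N : ℝ) ^ 2 := by
    have h1 : (T ℝ N).coeff 1 = (derivative (T ℝ N)).eval 0 := by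
      rw [← coeff_zero_eq_eval_zero, coeff_derivative]; simp
    obtain ⟨m, rfl⟩ := hN
    have h2 : (((2 * m + 1 : ℕ) : ℤ) - 1) = 2 * m := by push_cast; ring
    rw [h1, T_derivative_eq_U, h2, eval_mul, U_eval_two_mul_zero]
    rcases Int.units_eq_one_or ((m : ℤ).negOnePow) with h | h <;> (simp [h]; try ring)
  have hcoeff0 : (T ℝ N).coeff 1 ≠ 0 := fun h => by
    rw [h] at hcoeff
    have := pow_ne_zero 2 hN'
    simp_all
  have hT0 : (T ℝ N).coeff 0 = 0 := by
    rw [coeff_zero_eq_eval_zero]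
    exact T_eval_zero_of_odd ℝ (by exact_mod_cast hN)
  refine ⟨((T ℝ N).coeff 1)⁻¹, divX (divX (C ((T ℝ N).coeff 1)⁻¹ * T ℝ N)), ?_, ?_, ?_⟩
  · rw [inv_pow, hcoeff, one_div]
  · refine degree_le_natDegree.trans_lt ?_
    rw [natDegree_divX_eq_natDegree_tsub_one, natDegree_divX_eq_natDegree_tsub_one]
    have h1 : (C ((T ℝ N).coeff 1)⁻¹ * T ℝ N).natDegree ≤ N :=
      (natDegree_C_mul_le _ _).trans (by simp)
    exact_mod_cast (show _ - 1 - 1 < N by omega)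
  · set P := C ((T ℝ N).coeff 1)⁻¹ * T ℝ N with hP
    have h0 : P.coeff 0 = 0 := by rw [hP, coeff_C_mul, hT0, mul_zero]
    have h1 : P.coeff 1 = 1 := by rw [hP, coeff_C_mul, inv_mul_cancel₀ hcoeff0]
    have e1 := divX_mul_X_add P
    have e2 := divX_mul_X_add (divX P)
    rw [coeff_divX, zero_add, h1] at e2
    rw [h0] at e1
    rw [map_zero, add_zero] at e1
    rw [map_one] at e2
    linear_combination -e1 - X * e2

/-- `X (1 - X Q)` and `δ T_N = X + X² S` differ by `X² (S + Q)`. For the weights `1 / (|c i| xᵢ²)`,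
with `xᵢ` the nodes, this difference is orthogonal to `δ T_N`: the inner product is `δ` times a
divided difference of order `N` of a polynomial of degree `< N`. By Pythagoras `δ T_N` has least
weighted norm, and `(δ T_N)² = 1 / N²` at every node. -/
theorem exists_chebyshev_weights {N : ℕ} (hN : Odd N) :
    ∃ w : ℕ → ℝ, (∀ i ≤ N, 0 < w i) ∧ ∀ Q : ℝ[X], Q.degree < N →
      (∑ i ∈ Finset.range (N + 1), w i) / (N : ℝ) ^ 2
        ≤ ∑ i ∈ Finset.range (N + 1), w i * (node N i * (1 - node N i * Q.eval (node N i))) ^ 2 := by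
  have hT (i : ℕ) (hi : i ≤ N) : (T ℝ N).eval (node N i) = (-1) ^ i :=
    eval_T_real_node (Finset.mem_Iic.2 hi)
  -- For odd `N`, `T_N` vanishes at `0`, whereas it is `±1` at the nodes.
  have hnode (i : ℕ) (hi : i ≤ N) : node N i ≠ 0 := fun h => by
    have h1 := hT i hi
    rw [h, T_eval_zero_of_odd ℝ (by exact_mod_cast hN)] at h1
    exact pow_ne_zero i (by norm_num : (-1 : ℝ) ≠ 0) h1.symm
  set c : ℕ → ℝ := fun i => ∏ j ∈ (Finset.range (N + 1)).erase i, (node N i - node N j) with hc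
  have hcpos (i : ℕ) (hi : i ≤ N) : 0 < (-1) ^ i * c i := zero_lt_prod_node_sub_node hi
  refine ⟨fun i => ((-1) ^ i * c i)⁻¹ / node N i ^ 2, fun i hi => ?_, fun Q hQ => ?_⟩
  · have := hcpos i hi
    have := hnode i hi
    positivity
  obtain ⟨δ, S, hδ, hS, hTS⟩ := exists_scaled_T_eq hN
  have hr : (S + Q).degree < N := (degree_add_le _ _).trans_lt (max_lt hS hQ)
  have hinj : Set.InjOn (node N) (Finset.range (N + 1)) := (strictAntiOn_node N).injOn
  have horth : ∑ i ∈ Finset.range (N + 1), (S + Q).eval (node N i) / c i = 0 := by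
    rw [← Lagrange.coeff_eq_sum hinj
      (hr.trans (by rw [Finset.card_range]; exact_mod_cast N.lt_succ_self))]
    rw [Finset.card_range]
    exact coeff_eq_zero_of_degree_lt hr
  have key : ∀ i ∈ Finset.range (N + 1),
      ((-1) ^ i * c i)⁻¹ / node N i ^ 2 / (N : ℝ) ^ 2 - 2 * δ * ((S + Q).eval (node N i) / c i)
      ≤ ((-1) ^ i * c i)⁻¹ / node N i ^ 2 *
        (node N i * (1 - node N i * Q.eval (node N i))) ^ 2 := by
    intro i hi
    have hi : i ≤ N := Nat.lt_succ_iff.1 (Finset.mem_range.1 hi)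
    have h1 := congrArg (eval (node N i)) hTS
    simp only [eval_mul, eval_C, eval_add, eval_X, eval_pow, hT i hi] at h1
    have h2 := hcpos i hi
    have h3 := hnode i hi
    have h4 : node N i * (1 - node N i * Q.eval (node N i))
        = δ * (-1) ^ i - node N i ^ 2 * (S + Q).eval (node N i) := by
      rw [h1, eval_add]; ring
    rw [h4]
    set r := (S + Q).eval (node N i)
    have hs : ((-1 : ℝ) ^ i) ^ 2 = 1 := by rw [← pow_mul, mul_comm, pow_mul]; simp
    have hs0 : ((-1 : ℝ) ^ i) ≠ 0 := pow_ne_zero i (by norm_num)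
    have hc0 : c i ≠ 0 := fun h => by simp [h] at h2
    have h5 : ((-1) ^ i * c i)⁻¹ / node N i ^ 2 * (δ * (-1) ^ i - node N i ^ 2 * r) ^ 2
        = ((-1) ^ i * c i)⁻¹ / node N i ^ 2 * (δ ^ 2 * ((-1) ^ i) ^ 2) - 2 * δ * (r / c i)
          + ((-1) ^ i * c i)⁻¹ * node N i ^ 2 * r ^ 2 := by
      field_simp
      ring
    rw [h5, hs, hδ]
    have h6 : 0 ≤ ((-1) ^ i * c i)⁻¹ * node N i ^ 2 * r ^ 2 := by positivity
    rw [mul_one, mul_one_div]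
    linarith
  have := Finset.sum_le_sum key
  rw [Finset.sum_sub_distrib, ← Finset.mul_sum, horth, mul_zero, sub_zero, ← Finset.sum_div] at this
  exact this

theorem exists_hard_spectrum {N n : ℕ} (hN : Odd N) (hn : N + 1 ≤ n) {M : ℝ} (hM : 0 < M) :
    ∃ l s : Fin n → ℝ, (∀ j, |l j| ≤ 1) ∧ (∀ j, l j = 0 → s j = 0) ∧ ∑ j, s j ^ 2 = M ∧
      ∀ Q : ℝ[X], Q.degree < N →
        M / (N : ℝ) ^ 2 ≤ ∑ j, (l j * ((l j * Q.eval (l j) - 1) * s j)) ^ 2 := by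
  obtain ⟨w, hw, hQ⟩ := exists_chebyshev_weights hN
  set W := ∑ i ∈ Finset.range (N + 1), w i with hW
  have hWpos : 0 < W := Finset.sum_pos (fun i hi => hw i (Nat.lt_succ_iff.1 (Finset.mem_range.1 hi)))
    (by simp)
  have hsum (f : ℕ → ℝ) (hf : ∀ i, N < i → f i = 0) :
      ∑ j : Fin n, f j = ∑ i ∈ Finset.range (N + 1), f i := by
    rw [Fin.sum_univ_eq_sum_range]
    refine (Finset.sum_subset (Finset.range_mono hn) fun i _ hi => hf i ?_).symm
    simpa using hi
  set s : ℕ → ℝ := fun i => if i ≤ N then √(M / W * w i) else 0 with hs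
  have hs2 (i : ℕ) (hi : i ∈ Finset.range (N + 1)) : s i ^ 2 = M / W * w i := by
    have hi : i ≤ N := Nat.lt_succ_iff.1 (Finset.mem_range.1 hi)
    have := hw i hi
    simp only [hs, hi, if_true]
    exact Real.sq_sqrt (by positivity)
  have hs0 (i : ℕ) (hi : N < i) : s i = 0 := by simp [hs, hi]
  have hMW : M / W * W = M := by field_simp
  -- Coordinates beyond the `N + 1` nodes are padded by zero in both `l` and `s`.
  refine ⟨fun j => if (j : ℕ) ≤ N then node N j else 0, fun j => s j, ?_, ?_, ?_, ?_⟩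
  · intro j
    dsimp only
    split_ifs
    · exact abs_le.2 node_mem_Icc
    · simp
  · intro j hj
    refine hs0 j (not_le.1 fun hle => ?_)
    simp only [hle, if_true] at hj
    have h1 := eval_T_real_node (Finset.mem_Iic.2 hle)
    rw [hj, T_eval_zero_of_odd ℝ (by exact_mod_cast hN)] at h1
    exact pow_ne_zero _ (by norm_num : (-1 : ℝ) ≠ 0) h1.symm
  · rw [hsum (fun i => s i ^ 2) (fun i hi => by simp [hs0 i hi]), Finset.sum_congr rfl hs2,
      ← Finset.mul_sum, hMW]
  · intro Q hdeg
    have e : ∑ j : Fin n, ((if (j : ℕ) ≤ N then node N j else 0)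
        * (((if (j : ℕ) ≤ N then node N j else 0)
          * Q.eval (if (j : ℕ) ≤ N then node N j else 0) - 1) * s j)) ^ 2
        = M / W * ∑ i ∈ Finset.range (N + 1),
          w i * (node N i * (1 - node N i * Q.eval (node N i))) ^ 2 := by
      rw [hsum (fun i => ((if i ≤ N then node N i else 0)
        * (((if i ≤ N then node N i else 0)
          * Q.eval (if i ≤ N then node N i else 0) - 1) * s i)) ^ 2)
        (fun i hi => by simp [hs0 i hi]), Finset.mul_sum]
      refine Finset.sum_congr rfl fun i hi => ?_
      rw [← mul_assoc (M / W), ← hs2 i hi]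
      simp only [Nat.lt_succ_iff.1 (Finset.mem_range.1 hi), if_true]
      ring
    rw [e]
    calc M / (N : ℝ) ^ 2 = M / W * (W / (N : ℝ) ^ 2) := by field_simp
      _ ≤ _ := by gcongr; exact hQ Q hdeg

end ChebyshevWeights

/-! ### Bilinear saddle functions. -/

section InnerSub

variable {E : Type*} [NormedAddCommGroup E] [InnerProductSpace ℝ E]

theorem hasGradientAt_inner_sub [CompleteSpace E] (g a x : E) :
    HasGradientAt (fun x => ⟪g, x - a⟫) g x := by
  rw [hasGradientAt_iff_hasFDerivAt]
  exact (InnerProductSpace.toDual ℝ E g).hasFDerivAt.comp x ((hasFDerivAt_id x).sub_const a)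

theorem inner_sub_convex_combination (g a x y : E) {s t : ℝ} (hst : s + t = 1) :
    ⟪g, s • x + t • y - a⟫ = s • ⟪g, x - a⟫ + t • ⟪g, y - a⟫ := by
  have : s • x + t • y - a = s • (x - a) + t • (y - a) := by
    nth_rewrite 1 [← one_smul ℝ a, ← hst]; module
  rw [this, inner_add_right, inner_smul_right, inner_smul_right, smul_eq_mul, smul_eq_mul]

theorem convexOn_inner_sub (g a : E) : ConvexOn ℝ Set.univ (fun x => ⟪g, x - a⟫) :=
  ⟨convex_univ, fun x _ y _ _ _ _ _ h => (inner_sub_convex_combination g a x y h).le⟩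

theorem concaveOn_inner_sub (g a : E) : ConcaveOn ℝ Set.univ (fun x => ⟪g, x - a⟫) :=
  ⟨convex_univ, fun x _ y _ _ _ _ _ h => (inner_sub_convex_combination g a x y h).ge⟩

end InnerSub

section BilinearSaddle

variable {n : ℕ}

/-- The bilinear saddle function `⟪A (x - a), y - b⟫` with saddle point `p = (a, b)`. -/
noncomputable def bilinearSaddle (A : EuclideanSpace ℝ (Fin n) →L[ℝ] EuclideanSpace ℝ (Fin n))
    (p z : SaddleSpace n n) : ℝ := ⟪A (z.fst - p.fst), z.snd - p.snd⟫

variable {A : EuclideanSpace ℝ (Fin n) →L[ℝ] EuclideanSpace ℝ (Fin n)}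

theorem bilinearSaddle_left (hA : ∀ u v, ⟪A u, v⟫ = ⟪u, A v⟫) (p : SaddleSpace n n)
    (y : EuclideanSpace ℝ (Fin n)) :
    (fun x => bilinearSaddle A p (WithLp.toLp 2 (x, y)))
      = fun x => ⟪A (y - p.snd), x - p.fst⟫ := by
  funext x
  exact (hA _ _).trans (real_inner_comm _ _)

theorem gradX_bilinearSaddle (hA : ∀ u v, ⟪A u, v⟫ = ⟪u, A v⟫) (p z : SaddleSpace n n) :
    gradX (bilinearSaddle A p) z = A (z.snd - p.snd) := by
  rw [gradX, bilinearSaddle_left hA]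
  exact (hasGradientAt_inner_sub _ _ _).gradient

theorem gradY_bilinearSaddle (p z : SaddleSpace n n) :
    gradY (bilinearSaddle A p) z = A (z.fst - p.fst) :=
  (hasGradientAt_inner_sub (A (z.fst - p.fst)) p.snd z.snd).gradient

theorem bilinearSaddle_mem {R : ℝ} (hR : 0 ≤ R) (hA : ∀ u v, ⟪A u, v⟫ = ⟪u, A v⟫)
    (hAR : ∀ u, ‖A u‖ ≤ R * ‖u‖) (p : SaddleSpace n n) :
    bilinearSaddle A p ∈ SmoothConvexConcave n n R := by
  refine ⟨⟨?_, fun z w => ?_⟩, fun y => ?_, fun x => ?_⟩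
  · exact Differentiable.inner ℝ
      (A.differentiable.comp ((WithLp.fstL 2 ℝ _ (EuclideanSpace ℝ (Fin n))).differentiable.sub_const
        p.fst))
      ((WithLp.sndL 2 ℝ (EuclideanSpace ℝ (Fin n)) _).differentiable.sub_const p.snd)
  · have e : saddleOp (bilinearSaddle A p) z - saddleOp (bilinearSaddle A p) w
        = WithLp.toLp 2 (A (z.snd - w.snd), -A (z.fst - w.fst)) := by
      simp only [saddleOp, gradX_bilinearSaddle hA, gradY_bilinearSaddle, ← WithLp.toLp_sub,
        Prod.mk_sub_mk, map_sub]
      congr 2 <;> abel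
    rw [e]
    refine le_of_sq_le_sq ?_ (by positivity)
    rw [mul_pow, WithLp.prod_norm_sq_eq_of_L2, WithLp.prod_norm_sq_eq_of_L2]
    have h1 := pow_le_pow_left₀ (norm_nonneg _) (hAR (z.snd - w.snd)) 2
    have h2 := pow_le_pow_left₀ (norm_nonneg _) (hAR (z.fst - w.fst)) 2
    change ‖A (z.snd - w.snd)‖ ^ 2 + ‖-A (z.fst - w.fst)‖ ^ 2
      ≤ R ^ 2 * (‖z.fst - w.fst‖ ^ 2 + ‖z.snd - w.snd‖ ^ 2)
    rw [norm_neg]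
    linarith
  · rw [bilinearSaddle_left hA]
    exact convexOn_inner_sub _ _
  · exact concaveOn_inner_sub (A (x - p.fst)) p.snd

/-- The saddle points form `p + ker A × ker A`, and `z₀ - p` is orthogonal to this kernel. -/
theorem isClosestSaddlePoint_bilinearSaddle (hA : ∀ u v, ⟪A u, v⟫ = ⟪u, A v⟫)
    (p z₀ : SaddleSpace n n)
    (h₁ : ∀ e, A e = 0 → ⟪z₀.fst - p.fst, e⟫ = 0) (h₂ : ∀ e, A e = 0 → ⟪z₀.snd - p.snd, e⟫ = 0) :
    IsClosestSaddlePoint (bilinearSaddle A p) z₀ p := by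
  refine ⟨⟨fun y => ?_, fun x => ?_⟩, fun q hq => ?_⟩
  · simp [bilinearSaddle]
  · simp [bilinearSaddle]
  · have hd : Differentiable ℝ (bilinearSaddle A p) :=
      (bilinearSaddle_mem (norm_nonneg A) hA A.le_opNorm p).1.1
    have h0 := saddleOp_eq_zero hd hq
    have hx : A (q.snd - p.snd) = 0 := by
      rw [← gradX_bilinearSaddle hA]; exact congrArg WithLp.fst h0
    have hy : A (q.fst - p.fst) = 0 := by
      rw [← gradY_bilinearSaddle]; exact neg_eq_zero.1 (congrArg WithLp.snd h0)
    have horth : ⟪z₀ - p, q - p⟫ = 0 := by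
      have : ⟪z₀ - p, q - p⟫ = ⟪z₀.fst - p.fst, q.fst - p.fst⟫ + ⟪z₀.snd - p.snd, q.snd - p.snd⟫ :=
        rfl
      rw [this, h₁ _ hy, h₂ _ hx, add_zero]
    refine le_of_sq_le_sq ?_ (norm_nonneg _)
    have e : z₀ - q = (z₀ - p) - (q - p) := by abel
    rw [e, norm_sub_sq_real (z₀ - p), horth]
    nlinarith [sq_nonneg ‖q - p‖]

end BilinearSaddle

/-! ### Diagonal operators and Krylov spaces. -/

section Diagonal

variable {n : ℕ}

/-- The diagonal operator with entries `a`. -/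
noncomputable def diagonalCLM (a : Fin n → ℝ) : EuclideanSpace ℝ (Fin n) →L[ℝ] EuclideanSpace ℝ (Fin n) :=
  Matrix.toEuclideanCLM (𝕜 := ℝ) (Matrix.diagonal a)

@[simp]
theorem diagonalCLM_apply (a : Fin n → ℝ) (u : EuclideanSpace ℝ (Fin n)) (j : Fin n) :
    diagonalCLM a u j = a j * u j := by
  simp [diagonalCLM, Matrix.ofLp_toEuclideanCLM, Matrix.mulVec_diagonal]

theorem inner_diagonalCLM (a : Fin n → ℝ) (u v : EuclideanSpace ℝ (Fin n)) :
    ⟪diagonalCLM a u, v⟫ = ⟪u, diagonalCLM a v⟫ := by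
  simp only [PiLp.inner_apply, diagonalCLM_apply, RCLike.inner_apply, conj_trivial]
  exact Finset.sum_congr rfl fun j _ => by ring

theorem norm_diagonalCLM_le {a : Fin n → ℝ} {R : ℝ} (hR : 0 ≤ R) (ha : ∀ j, |a j| ≤ R)
    (u : EuclideanSpace ℝ (Fin n)) : ‖diagonalCLM a u‖ ≤ R * ‖u‖ := by
  refine le_of_sq_le_sq ?_ (by positivity)
  rw [mul_pow, EuclideanSpace.real_norm_sq_eq, EuclideanSpace.real_norm_sq_eq, Finset.mul_sum]
  refine Finset.sum_le_sum fun j _ => ?_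
  rw [diagonalCLM_apply, mul_pow]
  exact mul_le_mul_of_nonneg_right
    (sq_le_sq' (neg_le_of_abs_le (ha j)) (le_of_abs_le (ha j))) (sq_nonneg _)

/-- `Q ↦ (l_j Q(l_j) s_j)_j`; on polynomials of degree `< k` its range is the Krylov space of order
`k` of the diagonal operator `l` and the vector `l s`. -/
noncomputable def krylovMap (l s : Fin n → ℝ) : Polynomial ℝ →ₗ[ℝ] EuclideanSpace ℝ (Fin n) where
  toFun Q := WithLp.toLp 2 fun j => l j * Q.eval (l j) * s j
  map_add' P Q := by ext j; simp; ring
  map_smul' c Q := by ext j; simp; ring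

/-- The Krylov space of order `k` of the diagonal operator `l` and the vector `l s`. -/
noncomputable def krylovSpace (l s : Fin n → ℝ) (k : ℕ) : Submodule ℝ (EuclideanSpace ℝ (Fin n)) :=
  (Polynomial.degreeLT ℝ k).map (krylovMap l s)

theorem krylovSpace_mono (l s : Fin n → ℝ) : Monotone (krylovSpace l s) :=
  fun _ _ h => Submodule.map_mono (Polynomial.degreeLT_mono h)

/-- On polynomials this is `Q ↦ R (X Q - 1)`, which raises the degree bound by one. -/
theorem diagonalCLM_sub_mem_krylovSpace {l s : Fin n → ℝ} {k : ℕ} (R : ℝ)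
    {u : EuclideanSpace ℝ (Fin n)} (hu : u ∈ krylovSpace l s k) :
    diagonalCLM (fun j => R * l j) (u - WithLp.toLp 2 s) ∈ krylovSpace l s (k + 1) := by
  obtain ⟨Q, hQ, rfl⟩ := hu
  refine ⟨Polynomial.C R * (Polynomial.X * Q - 1), ?_, ?_⟩
  · rw [SetLike.mem_coe, Polynomial.C_mul']
    refine Submodule.smul_mem _ _ (Submodule.sub_mem _ ?_ ?_)
    · rw [SetLike.mem_coe, Polynomial.mem_degreeLT] at hQ
      rw [Polynomial.mem_degreeLT]
      rcases eq_or_ne Q 0 with rfl | h0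
      · simp
      · rw [Polynomial.degree_eq_natDegree h0] at hQ
        rw [Polynomial.degree_mul, Polynomial.degree_X, Polynomial.degree_eq_natDegree h0]
        norm_cast at hQ ⊢
        omega
    · rw [Polynomial.mem_degreeLT, Polynomial.degree_one]
      exact_mod_cast k.succ_pos
  · ext j
    simp [krylovMap]
    ring

end Diagonal

/-! ### The lower bound. -/

section LowerBound

variable {n : ℕ} {R : ℝ}

/-- On a bilinear problem with diagonal matrix, an algorithm of the class stays in the Krylov
spaces. -/
theorem iter_sub_mem_krylovSpace {l s : Fin n → ℝ} {z₀ p : SaddleSpace n n}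
    (hp₁ : p.fst = z₀.fst + WithLp.toLp 2 s) (hp₂ : p.snd = z₀.snd + WithLp.toLp 2 s)
    {A : MinimaxAlg n n} (hA : A ∈ AlgSep n n R)
    (hL : bilinearSaddle (diagonalCLM fun j => R * l j) p ∈ SmoothConvexConcave n n R) (k : ℕ) :
    (A.iter (bilinearSaddle (diagonalCLM fun j => R * l j) p) z₀ k).fst - z₀.fst
        ∈ krylovSpace l s k ∧
      (A.iter (bilinearSaddle (diagonalCLM fun j => R * l j) p) z₀ k).snd - z₀.snd
        ∈ krylovSpace l s k := by
  induction k using Nat.strong_induction_on with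
  | _ k ih =>
    -- The `x`-gradient depends on the `y`-error and conversely; the same displacement `s` in both
    -- blocks keeps them in one Krylov space.
    refine (hA _ hL z₀ k).imp (fun h => Submodule.span_le.2 ?_ h)
      (fun h => Submodule.span_le.2 ?_ h)
    · rintro g ⟨i, hi, rfl⟩
      rw [gradX_bilinearSaddle (inner_diagonalCLM _), hp₂, ← sub_sub]
      exact krylovSpace_mono l s hi (diagonalCLM_sub_mem_krylovSpace R (ih i hi).2)
    · rintro g ⟨i, hi, rfl⟩
      rw [gradY_bilinearSaddle, hp₁, ← sub_sub]
      exact krylovSpace_mono l s hi (diagonalCLM_sub_mem_krylovSpace R (ih i hi).1)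

theorem exists_hard_problem {D : ℝ} (hR : 0 < R) (hD : 0 < D) {k : ℕ} (hk : k + 2 ≤ n)
    {A : MinimaxAlg n n} (hA : A ∈ AlgSep n n R) (z₀ : SaddleSpace n n) :
    ∃ L ∈ SmoothConvexConcave n n R, ∃ p : SaddleSpace n n,
      IsClosestSaddlePoint L z₀ p ∧ ‖z₀ - p‖ = D ∧
      R ^ 2 * ‖z₀ - p‖ ^ 2 / (2 * ((k / 2 : ℕ) : ℝ) + 1) ^ 2
        ≤ ‖gradient L (A.iter L z₀ k)‖ ^ 2 := by
  have hM : 0 < D ^ 2 / 2 := by positivity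
  -- `2⌊k/2⌋ + 1` is the least odd number `≥ k`, so `deg Q < k` is covered, and its `N + 1 ≤ k + 2`
  -- nodes fit in dimension `n`. Each block receives half of `D²`.
  obtain ⟨l, s, hl, hls, hs, hQ⟩ := exists_hard_spectrum (N := 2 * (k / 2) + 1) (n := n)
    ⟨k / 2, rfl⟩ (by omega) hM
  set a : Fin n → ℝ := fun j => R * l j with ha
  have haR (j : Fin n) : |a j| ≤ R := by
    rw [ha, abs_mul, abs_of_pos hR]; exact mul_le_of_le_one_right hR.le (hl j)
  set p : SaddleSpace n n :=
    WithLp.toLp 2 (z₀.fst + WithLp.toLp 2 s, z₀.snd + WithLp.toLp 2 s) with hp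
  have hL : bilinearSaddle (diagonalCLM a) p ∈ SmoothConvexConcave n n R :=
    bilinearSaddle_mem hR.le (inner_diagonalCLM a) (norm_diagonalCLM_le hR.le haR) p
  have hp₁ : z₀.fst - p.fst = -WithLp.toLp 2 s := sub_add_cancel_left _ _
  have hp₂ : z₀.snd - p.snd = -WithLp.toLp 2 s := sub_add_cancel_left _ _
  have horth (e : EuclideanSpace ℝ (Fin n)) (he : diagonalCLM a e = 0) :
      ⟪-(WithLp.toLp 2 s : EuclideanSpace ℝ (Fin n)), e⟫ = 0 := by
    rw [inner_neg_left, neg_eq_zero, PiLp.inner_apply]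
    refine Finset.sum_eq_zero fun j _ => ?_
    have h := congrArg (fun v : EuclideanSpace ℝ (Fin n) => v j) he
    simp only [diagonalCLM_apply, ha, PiLp.zero_apply, mul_eq_zero, hR.ne', false_or] at h
    rcases h with h | h
    · simp [hls j h]
    · simp [h]
  have hnorm : ‖z₀ - p‖ = D := by
    refine (sq_eq_sq₀ (norm_nonneg _) hD.le).1 ?_
    rw [WithLp.prod_norm_sq_eq_of_L2]
    change ‖z₀.fst - p.fst‖ ^ 2 + ‖z₀.snd - p.snd‖ ^ 2 = D ^ 2
    rw [hp₁, hp₂, norm_neg, EuclideanSpace.real_norm_sq_eq, hs]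
    ring
  have hgrad {u : EuclideanSpace ℝ (Fin n)} (hu : u ∈ krylovSpace l s k) :
      R ^ 2 * (D ^ 2 / 2 / (2 * ((k / 2 : ℕ) : ℝ) + 1) ^ 2)
        ≤ ‖diagonalCLM a (u - WithLp.toLp 2 s)‖ ^ 2 := by
    obtain ⟨Q, hdeg, rfl⟩ := hu
    have hdeg : Q.degree < ((2 * (k / 2) + 1 : ℕ) : WithBot ℕ) :=
      (Polynomial.mem_degreeLT.1 hdeg).trans_le (by exact_mod_cast (by omega))
    have h := mul_le_mul_of_nonneg_left (hQ Q hdeg) (sq_nonneg R)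
    push_cast at h
    refine h.trans (le_of_eq ?_)
    rw [EuclideanSpace.real_norm_sq_eq, Finset.mul_sum]
    refine Finset.sum_congr rfl fun j _ => ?_
    simp [krylovMap, ha]
    ring
  refine ⟨_, hL, p, isClosestSaddlePoint_bilinearSaddle (inner_diagonalCLM a) p z₀
    (by rw [hp₁]; exact horth) (by rw [hp₂]; exact horth), hnorm, ?_⟩
  have hmem := iter_sub_mem_krylovSpace (p := p) rfl rfl hA hL k
  rw [norm_gradient_sq hL.1.1, gradX_bilinearSaddle (inner_diagonalCLM a), gradY_bilinearSaddle,
    hnorm]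
  have h₁ := hgrad hmem.1
  have h₂ := hgrad hmem.2
  rw [sub_sub] at h₁ h₂
  calc _ = R ^ 2 * (D ^ 2 / 2 / (2 * ((k / 2 : ℕ) : ℝ) + 1) ^ 2)
      + R ^ 2 * (D ^ 2 / 2 / (2 * ((k / 2 : ℕ) : ℝ) + 1) ^ 2) := by ring
    _ ≤ _ := add_le_add h₂ h₁

theorem le_worstCase {D : ℝ} (hR : 0 < R) (hD : 0 < D) {k : ℕ} (hk : k + 2 ≤ n)
    {A : MinimaxAlg n n} (hA : A ∈ AlgSep n n R) :
    ENNReal.ofReal (R ^ 2 * D ^ 2 / (2 * ((k / 2 : ℕ) : ℝ) + 1) ^ 2) ≤ worstCase R D A k := by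
  obtain ⟨L, hL, p, hp, hnorm, h⟩ := exists_hard_problem hR hD hk hA 0
  rw [hnorm] at h
  refine (ENNReal.ofReal_le_ofReal h).trans ?_
  have hmem : (0 : SaddleSpace n n) ∈ Metric.closedBall p D := by
    rw [Metric.mem_closedBall, dist_eq_norm, hnorm]
  exact le_iSup₂_of_le L hL (le_iSup₂_of_le p hp.1 (le_iSup₂_of_le 0 hmem le_rfl))

end LowerBound

/-! ### Comparison of the two bounds. -/

section Optimality

theorem HasQuadraticRate.mono {c c' R : ℝ} {E : (n m : ℕ) → MinimaxAlg n m} (hc : c ≤ c')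
    (h : HasQuadraticRate c R E) : HasQuadraticRate c' R E :=
  fun n m L hL p hp z₀ k => (h n m L hL p hp z₀ k).trans (by gcongr)

/-- From `N ≤ 2k` follows `2⌊N/2⌋ + 1 ≤ 2 (k + 1)`; the square of this `2` is the factor `4`. -/
theorem HasQuadraticRate.isOptimalUpTo {c R : ℝ} {E : (n m : ℕ) → MinimaxAlg n m} (hR : 0 < R)
    (hc : 0 ≤ c) (h : HasQuadraticRate c R E) (hE : ∀ n m, E n m ∈ AlgSep n m R) :
    IsOptimalUpTo (4 * c) R E := by
  refine ⟨hE, fun D hD n k N hN hn A hA => ?_⟩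
  have hup : worstCase R D (E n n) (2 * k)
      ≤ ENNReal.ofReal (c * R ^ 2 * D ^ 2 / ((k : ℝ) + 1) ^ 2) := by
    refine iSup₂_le fun L hL => iSup₂_le fun p hp => iSup₂_le fun z₀ hz₀ => ?_
    rw [Metric.mem_closedBall, dist_eq_norm] at hz₀
    exact ENNReal.ofReal_le_ofReal ((h n n L hL p hp z₀ k).trans (by gcongr))
  refine hup.trans (le_trans ?_ (mul_le_mul_right (le_worstCase hR hD hn hA) _))
  rw [← ENNReal.ofReal_mul (by positivity)]
  refine ENNReal.ofReal_le_ofReal ?_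
  have hkN : ((N / 2 : ℕ) : ℝ) ≤ k := by exact_mod_cast (by omega : N / 2 ≤ k)
  have e : c * R ^ 2 * D ^ 2 / ((k : ℝ) + 1) ^ 2
      = 4 * c * (R ^ 2 * D ^ 2 / (2 * (k : ℝ) + 2) ^ 2) := by
    field_simp
    ring
  rw [e]
  gcongr
  norm_num

end Optimality

theorem corollary3 :
    -- the lower bound for every algorithm of the class
    (∀ (R D : ℝ), 0 < R → 0 < D → ∀ (k n : ℕ), k + 2 ≤ n → ∀ A ∈ AlgSep n n R,
      (∀ z₀ : SaddleSpace n n, ∃ L ∈ SmoothConvexConcave n n R, ∃ p : SaddleSpace n n,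
        IsClosestSaddlePoint L z₀ p ∧ ‖z₀ - p‖ = D ∧
        R ^ 2 * ‖z₀ - p‖ ^ 2 / (2 * ((k / 2 : ℕ) : ℝ) + 1) ^ 2
          ≤ ‖gradient L (A.iter L z₀ k)‖ ^ 2) ∧
      ENNReal.ofReal (R ^ 2 * D ^ 2 / (2 * ((k / 2 : ℕ) : ℝ) + 1) ^ 2) ≤ worstCase R D A k) ∧
    -- EAG-C is optimal up to a constant that depends on `α * R` only
    (∃ C : ℝ → ℝ, ∀ R α : ℝ, 0 < R → 0 < α →
      0 ≤ 1 - 3 * (α * R) - (α * R) ^ 2 - (α * R) ^ 3 →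
      0 ≤ 1 - 8 * (α * R) + (α * R) ^ 2 - 2 * (α * R) ^ 3 →
      HasQuadraticRate (C (α * R)) R (fun n m => eagC n m α) ∧
      IsOptimalUpTo (C (α * R)) R (fun n m => eagC n m α)) ∧
    -- EAG-V is optimal up to a constant that depends on `α₀ * R` only
    (∃ C : ℝ → ℝ, ∀ R α₀ : ℝ, 0 < R → 0 < α₀ → α₀ < 3 / (4 * R) →
      HasQuadraticRate (C (α₀ * R)) R (fun n m => eagV n m R α₀) ∧
      IsOptimalUpTo (C (α₀ * R)) R (fun n m => eagV n m R α₀)) := by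
  refine ⟨fun R D hR hD k n hk A hA =>
      ⟨fun z₀ => exists_hard_problem hR hD hk hA z₀, le_worstCase hR hD hk hA⟩,
    ⟨fun t => 4 * ((4 + 3 * t ^ 2) / t ^ 2), fun R α hR hα _ h => ?_⟩,
    ⟨fun t => 4 * ((4 + t ^ 2) / (t / 4) ^ 2), fun R α₀ hR hα₀ h => ?_⟩⟩
  · have ht : α * R ≤ 1 / 7 := by
      by_contra! hlt
      have h0 : 0 < α * R := by positivity
      nlinarith [sq_nonneg (α * R - 1 / 3), mul_nonneg h0.le (sq_nonneg (α * R - 1 / 3))]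
    have hrate := eagC_hasQuadraticRate hR hα ht
    have hc : 0 ≤ (4 + 3 * (α * R) ^ 2) / (α * R) ^ 2 := by positivity
    exact ⟨hrate.mono (by linarith),
      hrate.isOptimalUpTo hR hc fun n m => eag_mem_algSep n m R _⟩
  · have hrate := eagV_hasQuadraticRate hR hα₀ h
    have hc : 0 ≤ (4 + (α₀ * R) ^ 2) / ((α₀ * R) / 4) ^ 2 := by positivity
    exact ⟨hrate.mono (by linarith),
      hrate.isOptimalUpTo hR hc fun n m => eag_mem_algSep n m R _⟩
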